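/- Let $n\ge 0$, $d=2^n$, and let $\mathbb P$ be the set of the $4^n$ Pauli strings $\sigma_1\otimes\cdots\otimes\sigma_n$, $\sigma_k\in\{I,X,Y,Z\}$, acting on $\mathcal H=(\mathbb C^2)^{\otimes n}$. Let $\mathcal G\subseteq\mathbb P$ be any set of Pauli strings, let $\mathfrak g=\langle i\mathcal G\rangle_{\mathrm{Lie}}$ be the smallest real Lie algebra of operators containing $iP$ for all $P\in\mathcal G$ (with the commutator as bracket), let $G=\exp\mathfrak g\subseteq\mathbb U(d)$ be the corresponding compact Lie group, that is, the closed subgroup of $\mathbb U(d)$ generated by the unitaries $e^{A}$, $A\in\mathfrak g$, and let $\mu_G$ be the Haar probability measure on $G$. The commutator graph of $\mathcal G$ has vertex set $\mathbb P$, and $P,Q\in\mathbb P$ are adjacent if there are $X\in\mathcal G$ and a scalar $c\ne 0$ with $[P,X]=cQ$; write $C(P)$ for the (vertex set of the) connected component of $P$. For unitary operators $A,B$ on $\mathcal H$ let $F(A,B)=\frac1d\operatorname{tr}\left[A^\dagger B^\dagger AB\right]$ be the out-of-time-order correlator. Then, for all Pauli strings $V,W\in\mathbb P$, the function $U\mapsto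 F(W,U^\dagger VU)$ is $\mu_G$-integrable, and \begin{align*} \mathbb E_{U\sim\mu_G}\,F(W,U^\dagger VU)&=1-\frac{2\,|\{T\in C(V):\{W,T\}=0\}|}{|C(V)|}\\ &=1-\frac{2\,|\{T\in C(W):\{V,T\}=0\}|}{|C(W)|}, \end{align*} where $\{A,B\}=AB+BA$ denotes the anticommutator. -/

import Mathlib

open MeasureTheory

attribute [local instance 100] LieRing.ofAssociativeRing

/-- The four single-qubit Pauli labels. -/
inductive Pauli where
  | I | X | Y | Z
  deriving DecidableEq

instance Pauli.instFintype : Fintype Pauli :=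
  ⟨{.I, .X, .Y, .Z}, fun p => by cases p <;> decide⟩

/-- The `2 × 2` matrix of a single-qubit Pauli operator. -/
def Pauli.toMatrix : Pauli → Matrix (Fin 2) (Fin 2) ℂ
  | .I => 1
  | .X => !![0, 1; 1, 0]
  | .Y => !![0, -Complex.I; Complex.I, 0]
  | .Z => !![1, 0; 0, -1]

/-- The index set of the computational basis of `n` qubits; it has `2 ^ n` elements. -/
abbrev Qubits (n : ℕ) : Type := Fin n → Fin 2

/-- The operators on the Hilbert space of `n` qubits. -/
abbrev Operator (n : ℕ) : Type := Matrix (Qubits n) (Qubits n) ℂ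

/-- The unitary group `𝕌(2 ^ n)`. -/
abbrev UGroup (n : ℕ) : Type := Matrix.unitaryGroup (Qubits n) ℂ

/-- The `4 ^ n` Pauli strings (without phases) on `n` qubits. -/
abbrev PauliString (n : ℕ) : Type := Fin n → Pauli

/-- The operator `σ_{p 0} ⊗ ⋯ ⊗ σ_{p (n - 1)}` of a Pauli string `p`. -/
def PauliString.op {n : ℕ} (p : PauliString n) : Operator n :=
  fun i j => ∏ k, (p k).toMatrix (i k) (j k)

theorem PauliString.op_mul_apply {n : ℕ} (p q : PauliString n) (i j : Qubits n) :
    (p.op * q.op) i j = ∏ k, ((p k).toMatrix * (q k).toMatrix) (i k) (j k) := by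
  simp only [Matrix.mul_apply, PauliString.op, ← Finset.prod_mul_distrib]
  rw [Finset.prod_univ_sum, Fintype.piFinset_univ]

theorem Pauli.mul_self (a : Pauli) : a.toMatrix * a.toMatrix = 1 := by
  cases a <;> ext i j <;> fin_cases i <;> fin_cases j <;>
    simp [Pauli.toMatrix, Matrix.mul_apply, Fin.sum_univ_two]

theorem Pauli.exists_sign (a b : Pauli) :
    ∃ e : ℂ, (e = 1 ∨ e = -1) ∧ a.toMatrix * b.toMatrix = e • (b.toMatrix * a.toMatrix) := by
  cases a <;> cases b <;>
    first
    | (refine ⟨1, Or.inl rfl, Matrix.ext fun i j => ?_⟩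
       fin_cases i <;> fin_cases j <;>
         (simp [Pauli.toMatrix, Matrix.mul_apply, Fin.sum_univ_two]; done))
    | (refine ⟨-1, Or.inr rfl, Matrix.ext fun i j => ?_⟩
       fin_cases i <;> fin_cases j <;>
         simp [Pauli.toMatrix, Matrix.mul_apply, Fin.sum_univ_two])

theorem PauliString.op_mul_self {n : ℕ} (p : PauliString n) : p.op * p.op = 1 := by
  ext i j
  rw [PauliString.op_mul_apply]
  simp only [Pauli.mul_self, Matrix.one_apply]
  by_cases h : i = j
  · simp [h]
  · obtain ⟨k, hk⟩ := Function.ne_iff.mp h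
    rw [if_neg h]
    exact Finset.prod_eq_zero (Finset.mem_univ k) (if_neg hk)

/-- Two Pauli strings either commute or anticommute. -/
theorem PauliString.commute_or_anticommute {n : ℕ} (p q : PauliString n) :
    p.op * q.op = q.op * p.op ∨ p.op * q.op = -(q.op * p.op) := by
  choose e he h using fun k => Pauli.exists_sign (p k) (q k)
  have key : p.op * q.op = (∏ k, e k) • (q.op * p.op) := by
    ext i j
    rw [Matrix.smul_apply, PauliString.op_mul_apply, PauliString.op_mul_apply, smul_eq_mul,
      ← Finset.prod_mul_distrib]
    exact Finset.prod_congr rfl fun k _ => by rw [h k, Matrix.smul_apply, smul_eq_mul]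
  have hs : (∏ k, e k) = 1 ∨ (∏ k, e k) = -1 :=
    Finset.prod_induction e (fun z => z = 1 ∨ z = -1)
      (by rintro a b (rfl | rfl) (rfl | rfl) <;> simp) (Or.inl rfl) fun k _ => he k
  rcases hs with hs | hs
  · left; rw [key, hs, one_smul]
  · right; rw [key, hs, neg_one_smul]

/-- `[p, X]` is a nonzero multiple of `q`. -/
def CommutatorRel {n : ℕ} (p X q : PauliString n) : Prop :=
  ∃ c : ℂ, c ≠ 0 ∧ ⁅p.op, X.op⁆ = c • q.op

theorem CommutatorRel.anticommute {n : ℕ} {p X q : PauliString n} (h : CommutatorRel p X q) :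
    p.op * X.op = -(X.op * p.op) := by
  obtain ⟨c, hc, h⟩ := h
  refine (p.commute_or_anticommute X).resolve_left fun hcomm => ?_
  rw [Ring.lie_def, hcomm, sub_self] at h
  have hq : q.op = 0 := (smul_eq_zero.mp h.symm).resolve_left hc
  have h1 := q.op_mul_self
  rw [hq, zero_mul] at h1
  exact zero_ne_one h1

theorem CommutatorRel.symm {n : ℕ} {p X q : PauliString n} (h : CommutatorRel p X q) :
    CommutatorRel q X p := by
  have ha := h.anticommute
  obtain ⟨c, hc, h⟩ := h
  have hx := X.op_mul_self
  have e1 : c • q.op = (2 : ℂ) • (p.op * X.op) := by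
    rw [← h, Ring.lie_def, ha, two_smul]
    abel
  have e2 : q.op = (c⁻¹ * 2) • (p.op * X.op) := by
    rw [mul_smul, ← e1, smul_smul, inv_mul_cancel₀ hc, one_smul]
  have e3 : p.op * X.op * X.op = p.op := by rw [mul_assoc, hx, mul_one]
  have e4 : X.op * (p.op * X.op) = -p.op := by
    rw [ha, mul_neg, ← mul_assoc, hx, one_mul]
  refine ⟨c⁻¹ * 2 * 2, by simp [hc], ?_⟩
  rw [Ring.lie_def, e2, smul_mul_assoc, mul_smul_comm, e3, e4, smul_neg, sub_neg_eq_add,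
    ← two_smul ℂ, smul_smul]
  congr 1
  ring

theorem CommutatorRel.irrefl {n : ℕ} (p X : PauliString n) : ¬ CommutatorRel p X p := by
  intro hp
  have ha := hp.anticommute
  obtain ⟨c, hc, h⟩ := hp
  have hpp := p.op_mul_self
  have e1 : c • p.op = (2 : ℂ) • (p.op * X.op) := by
    rw [← h, Ring.lie_def, ha, two_smul]
    abel
  have e2 : X.op = (c / 2) • (1 : Operator n) := by
    have e := congrArg (fun M => (2 : ℂ)⁻¹ • (p.op * M)) e1
    simp only [mul_smul_comm, ← mul_assoc, hpp, one_mul, smul_smul] at e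
    rw [inv_mul_cancel₀ two_ne_zero, one_smul] at e
    rw [← e]
    congr 1
    ring
  rw [Ring.lie_def, e2, mul_smul_comm, smul_mul_assoc, mul_one, one_mul, sub_self] at h
  have hq : p.op = 0 := (smul_eq_zero.mp h.symm).resolve_left hc
  rw [hq, zero_mul] at hpp
  exact zero_ne_one hpp

/-- The commutator graph of a set `𝒢` of Pauli strings: its vertices are all the Pauli strings, and
`p`, `q` are joined if `[p, X]` is a nonzero multiple of `q` for some `X ∈ 𝒢`. -/
def commutatorGraph {n : ℕ} (𝒢 : Set (PauliString n)) : SimpleGraph (PauliString n) where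
  Adj p q := ∃ X ∈ 𝒢, CommutatorRel p X q
  symm := ⟨fun _ _ ⟨X, hX, h⟩ => ⟨X, hX, h.symm⟩⟩
  loopless := ⟨fun _ ⟨_, _, h⟩ => CommutatorRel.irrefl _ _ h⟩

/-- The set of vertices of the connected component of the Pauli string `V`. -/
def component {n : ℕ} (𝒢 : Set (PauliString n)) (V : PauliString n) : Set (PauliString n) :=
  ((commutatorGraph 𝒢).connectedComponentMk V).supp

/-- The Pauli strings in the component of `V` that anticommute with `W`. -/
def anticommutingIn {n : ℕ} (𝒢 : Set (PauliString n)) (V W : PauliString n) :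
    Set (PauliString n) :=
  {T | T ∈ component 𝒢 V ∧ W.op * T.op + T.op * W.op = 0}

/-- The dynamical Lie algebra `𝔤 = ⟨i𝒢⟩_Lie`: the smallest real Lie algebra of operators that
contains `i p` for every `p ∈ 𝒢`. -/
noncomputable def dynamicalLieAlgebra {n : ℕ} (𝒢 : Set (PauliString n)) :
    LieSubalgebra ℝ (Operator n) :=
  LieSubalgebra.lieSpan ℝ (Operator n) {M | ∃ p ∈ 𝒢, M = Complex.I • p.op}

/-- The compact Lie group `G = exp 𝔤`, built as the closed subgroup of the unitary group generated
by the exponentials of the elements of `𝔤` (all of which are unitary).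

Neither generating nor closing adds anything to `exp 𝔤`. Indeed `𝔤` is spanned by operators `i S`
with `S` Pauli strings; it is the sum of its centre, which is spanned by the `i S` in `𝔤` that
commute with all the others and so exponentiates to a torus (a product of circles), and of the
semisimple algebra `[𝔤, 𝔤]`, which consists of skew-Hermitian matrices and so exponentiates to a
compact group. Hence `exp 𝔤` is already a compact group. -/
noncomputable def dynamicalGroup {n : ℕ} (𝒢 : Set (PauliString n)) : Subgroup (UGroup n) :=
  (Subgroup.closure
    {U : UGroup n | ∃ A ∈ dynamicalLieAlgebra 𝒢, (U : Operator n) = NormedSpace.exp A}).topologicalClosure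

theorem isCompact_unitary (n : ℕ) :
    IsCompact (Matrix.unitaryGroup (Qubits n) ℂ : Set (Operator n)) := by
  have hK : IsCompact (Set.pi Set.univ fun _ : Qubits n => Set.pi Set.univ fun _ : Qubits n =>
      Metric.closedBall (0 : ℂ) 1) :=
    isCompact_univ_pi fun _ => isCompact_univ_pi fun _ => isCompact_closedBall 0 1
  refine IsCompact.of_isClosed_subset hK (isClosed_unitary (R := Operator n)) fun U hU i _ j _ => ?_
  simpa using entry_norm_bound_of_unitary hU i j

instance instCompactSpaceUGroup (n : ℕ) : CompactSpace (UGroup n) :=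
  isCompact_iff_compactSpace.mp (isCompact_unitary n)

instance instCompactSpaceDynamicalGroup {n : ℕ} (𝒢 : Set (PauliString n)) :
    CompactSpace (dynamicalGroup 𝒢) :=
  isCompact_iff_compactSpace.mp (Subgroup.isClosed_topologicalClosure _).isCompact

/-- The Borel σ-algebra. -/
noncomputable instance instMeasurableSpaceDynamicalGroup {n : ℕ} (𝒢 : Set (PauliString n)) :
    MeasurableSpace (dynamicalGroup 𝒢) := borel _

instance instBorelSpaceDynamicalGroup {n : ℕ} (𝒢 : Set (PauliString n)) :
    BorelSpace (dynamicalGroup 𝒢) := ⟨rfl⟩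

/-- The Haar measure `μ_G` of `G`, normalised to total mass one. -/
noncomputable def haarMeasureG {n : ℕ} (𝒢 : Set (PauliString n)) : Measure (dynamicalGroup 𝒢) :=
  Measure.haarMeasure ⊤

/-- The out-of-time-order correlator `F(W, V) = d⁻¹ tr [W† V† W V]`, where `d = 2 ^ n`. -/
noncomputable def otoc {n : ℕ} (W V : Operator n) : ℂ :=
  (1 / (2 : ℂ) ^ n) * (W.conjTranspose * V.conjTranspose * W * V).trace

/-- The Heisenberg-evolved operator `U† V U`. -/
def heisenberg {n : ℕ} (U : UGroup n) (V : Operator n) : Operator n :=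
  (U : Operator n).conjTranspose * V * (U : Operator n)

/-! The complex span of `C(V)` is stable under bracketing with each `iX`, `X ∈ 𝒢`, hence under `ad
𝔤`, hence under conjugation by `G` (`dynamicalGroup_le_unitaryStabilizer`). So `U†VU = ∑ c_T(U) T`
with `T` running over `C(V)` only. Since `U†VU` is a Hermitian involution, orthogonality of Pauli
strings under the trace gives `∑ c_T² = 1` and `F(W, U†VU) = ∑ ± c_T²`, the sign being `-1` exactly
when `T` anticommutes with `W` (`sum_pauliCoeff_sq`, `otoc_eq_sum`).

The average of `c_T²` is constant on `C(V)`: if `X ∈ 𝒢` joins `S` to `T`, then `g = (1 + iX)/√2`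
lies in `G` and `gSg† = ±T`, so right translation by `g` turns `c_S²` into `c_T²`
(`exists_pauliCoeff_sq_mul_eq`). Each average is therefore `1/|C(V)|`, and summing signs gives the
first formula. The second follows from the first with `V` and `W` exchanged, because Haar measure is
invariant under inversion and `F(W, UVU†) = F(V, U†WU)`. -/

/-- If `ad A` preserves a closed subspace, so does conjugation by `exp A`. -/
theorem exp_mul_mul_exp_neg_mem {R : Type*} [NormedRing R] [NormedAlgebra ℂ R] [CompleteSpace R]
    (S : Submodule ℂ R) (hS : IsClosed (S : Set R)) {A M : R}
    (hA : ∀ B ∈ S, A * B - B * A ∈ S) (hM : M ∈ S) :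
    NormedSpace.exp A * M * NormedSpace.exp (-A) ∈ S := by
  let _ : NormedAlgebra ℚ R := NormedAlgebra.restrictScalars ℚ ℂ R
  let _ : NormedAlgebra ℚ (R →L[ℂ] R) := NormedAlgebra.restrictScalars ℚ ℂ _
  -- Left and right multiplications commute, so `exp (l A + r (-A))` factors into conjugation by
  -- `exp A`, while the exponent itself is `ad A`.
  let l : R →+* (R →L[ℂ] R) :=
    { toFun := ContinuousLinearMap.mul ℂ R
      map_one' := by ext; simp
      map_zero' := map_zero _
      map_add' := map_add _
      map_mul' := fun a b => by ext x; simp [mul_assoc] }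
  let r : Rᵐᵒᵖ →+* (R →L[ℂ] R) :=
    { toFun := fun a => (ContinuousLinearMap.mul ℂ R).flip a.unop
      map_one' := by ext; simp
      map_zero' := by ext; simp
      map_add' := fun a b => by ext; simp
      map_mul' := fun a b => by ext x; simp [mul_assoc] }
  have hl : Continuous l := (ContinuousLinearMap.mul ℂ R).continuous
  have hr : Continuous r :=
    (ContinuousLinearMap.mul ℂ R).flip.continuous.comp MulOpposite.continuous_unop
  have hcomm : Commute (l A) (r (MulOpposite.op (-A))) := by
    ext x; simp [l, r, mul_assoc]
  -- The operators preserving `S` form a closed subalgebra, which contains `exp f` whenever it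
  -- contains `f`.
  let P : Subalgebra ℂ (R →L[ℂ] R) :=
    { carrier := {f | ∀ B ∈ S, f B ∈ S}
      mul_mem' := fun hf hg B hB => hf _ (hg B hB)
      add_mem' := fun hf hg B hB => S.add_mem (hf B hB) (hg B hB)
      algebraMap_mem' := fun c B hB => by
        simpa [Algebra.algebraMap_eq_smul_one] using S.smul_mem c hB }
  have hP : IsClosed (P : Set (R →L[ℂ] R)) := by
    have : (P : Set (R →L[ℂ] R)) = ⋂ B ∈ S, (fun f : R →L[ℂ] R => f B) ⁻¹' (S : Set R) := by
      ext f
      simp only [Set.mem_iInter, Set.mem_preimage, SetLike.mem_coe]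
      exact Iff.rfl
    rw [this]
    exact isClosed_biInter fun B _ => hS.preimage (by fun_prop)
  have hmem : NormedSpace.exp (l A + r (MulOpposite.op (-A))) ∈ P := by
    refine NormedSpace.exp_mem (s := P) hP ?_
    intro B hB
    simpa [l, r, sub_eq_add_neg] using hA B hB
  rw [NormedSpace.exp_add_of_commute hcomm, ← NormedSpace.map_exp l hl,
    ← NormedSpace.map_exp r hr, NormedSpace.exp_op] at hmem
  simpa [l, r, mul_assoc] using hmem M hM

/-! ### Invariance of Haar probability measures -/

/-- Haar measure on a compact group is right invariant. -/
theorem isMulRightInvariant_of_isProbabilityMeasure {G : Type*} [Group G] [TopologicalSpace G]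
    [IsTopologicalGroup G] [LocallyCompactSpace G] [MeasurableSpace G] [BorelSpace G]
    (μ : Measure G) [μ.IsHaarMeasure] [IsProbabilityMeasure μ] : μ.IsMulRightInvariant := by
  refine ⟨fun g => ?_⟩
  -- A right translate of `μ` is again a Haar probability measure, and such a measure is unique.
  have : IsProbabilityMeasure (μ.map (· * g)) :=
    Measure.isProbabilityMeasure_map (measurable_mul_const g).aemeasurable
  exact Measure.isHaarMeasure_eq_of_isProbabilityMeasure _ _

/-- Inversion turns right invariance into left invariance, so `μ.inv` is a Haar probability measure
and uniqueness applies. -/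
theorem isInvInvariant_of_isProbabilityMeasure {G : Type*} [Group G] [TopologicalSpace G]
    [IsTopologicalGroup G] [LocallyCompactSpace G] [MeasurableSpace G] [BorelSpace G]
    (μ : Measure G) [μ.IsHaarMeasure] [IsProbabilityMeasure μ] : μ.IsInvInvariant := by
  have := isMulRightInvariant_of_isProbabilityMeasure μ
  have : IsProbabilityMeasure μ.inv :=
    Measure.isProbabilityMeasure_map measurable_inv.aemeasurable
  have : μ.inv.IsHaarMeasure :=
    { toIsMulLeftInvariant := inferInstance
      toIsFiniteMeasureOnCompacts := inferInstance
      toIsOpenPosMeasure := inferInstance }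
  exact ⟨Measure.isHaarMeasure_eq_of_isProbabilityMeasure _ _⟩

/-! ### Exponentials of involutions and the algebra of Pauli strings -/

/-- Euler's formula for an involution. -/
theorem exp_involution {R : Type*} [NormedRing R] [NormedAlgebra ℂ R] [CompleteSpace R] {X : R}
    (hX : X * X = 1) (z : ℂ) :
    NormedSpace.exp ((z * Complex.I) • X) =
      Complex.cos z • (1 : R) + (Complex.sin z * Complex.I) • X := by
  let _ : NormedAlgebra ℚ R := NormedAlgebra.restrictScalars ℚ ℂ R
  -- Functional calculus for `X`: the pair `w` lists the values at the eigenvalues `1` and `-1`, so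
  -- the exponential is computed componentwise in `ℂ × ℂ`.
  let φ : ℂ × ℂ →+* R :=
    { toFun := fun w => ((w.1 + w.2) / 2) • (1 : R) + ((w.1 - w.2) / 2) • X
      map_one' := by simp
      map_zero' := by simp
      map_add' := fun a b => by simp only [Prod.fst_add, Prod.snd_add]; module
      map_mul' := fun a b => by
        simp only [add_mul, mul_add, smul_mul_smul, one_mul, mul_one, hX, Prod.fst_mul, Prod.snd_mul]
        module }
  have hφ : Continuous φ := by
    change Continuous fun w : ℂ × ℂ => ((w.1 + w.2) / 2) • (1 : R) + ((w.1 - w.2) / 2) • X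
    fun_prop
  have h := NormedSpace.map_exp φ hφ (z * Complex.I, -z * Complex.I)
  have e : NormedSpace.exp ((z * Complex.I, -z * Complex.I) : ℂ × ℂ)
      = (Complex.exp (z * Complex.I), Complex.exp (-z * Complex.I)) := by
    ext <;> simp [Complex.exp_eq_exp_ℂ]
  rw [e] at h
  have e2 : φ (z * Complex.I, -z * Complex.I) = (z * Complex.I) • X := by
    change ((z * Complex.I + -z * Complex.I) / 2) • (1 : R)
      + ((z * Complex.I - -z * Complex.I) / 2) • X = _
    module
  rw [← e2, ← h]
  change ((Complex.exp (z * Complex.I) + Complex.exp (-z * Complex.I)) / 2) • (1 : R)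
    + ((Complex.exp (z * Complex.I) - Complex.exp (-z * Complex.I)) / 2) • X = _
  rw [Complex.cos, Complex.sin, div_mul_eq_mul_div, mul_assoc, Complex.I_mul_I]
  module

theorem Pauli.exists_mul (a b : Pauli) :
    ∃ c : ℂ, ∃ r : Pauli, c ≠ 0 ∧ a.toMatrix * b.toMatrix = c • r.toMatrix := by
  cases a
  case I => exact ⟨1, b, one_ne_zero, by simp [Pauli.toMatrix]⟩
  all_goals
    cases b
    case I => exact ⟨1, _, one_ne_zero, (mul_one _).trans (one_smul ℂ _).symm⟩
  case X.X | Y.Y | Z.Z => exact ⟨1, .I, one_ne_zero, by rw [Pauli.mul_self, one_smul]; rfl⟩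
  case X.Y => exact ⟨Complex.I, .Z, by simp, by simp [Pauli.toMatrix]⟩
  case X.Z => exact ⟨-Complex.I, .Y, by simp, by simp [Pauli.toMatrix]⟩
  case Y.X => exact ⟨-Complex.I, .Z, by simp, by simp [Pauli.toMatrix]⟩
  case Y.Z => exact ⟨Complex.I, .X, by simp, by simp [Pauli.toMatrix]⟩
  case Z.X => exact ⟨Complex.I, .Y, by simp, by simp [Pauli.toMatrix]⟩
  case Z.Y => exact ⟨-Complex.I, .X, by simp, by simp [Pauli.toMatrix]⟩

theorem Pauli.trace_mul (a b : Pauli) :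
    (a.toMatrix * b.toMatrix).trace = if a = b then 2 else 0 := by
  split_ifs with h
  · subst h; simp [Pauli.mul_self]
  · cases a <;> cases b <;> first
      | exact absurd rfl h
      | simp [Pauli.toMatrix, Matrix.trace_fin_two]

theorem Pauli.conjTranspose_toMatrix (a : Pauli) : a.toMatrix.conjTranspose = a.toMatrix := by
  cases a <;> ext i j <;> fin_cases i <;> fin_cases j <;>
    simp [Pauli.toMatrix, Matrix.conjTranspose_apply]

namespace PauliString

variable {n : ℕ}

theorem exists_mul (p q : PauliString n) :
    ∃ c : ℂ, ∃ r : PauliString n, c ≠ 0 ∧ p.op * q.op = c • r.op := by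
  choose c r hc h using fun k => Pauli.exists_mul (p k) (q k)
  refine ⟨∏ k, c k, r, Finset.prod_ne_zero_iff.mpr fun k _ => hc k, ?_⟩
  ext i j
  rw [op_mul_apply, Matrix.smul_apply, smul_eq_mul, op, ← Finset.prod_mul_distrib]
  exact Finset.prod_congr rfl fun k _ => by rw [h k, Matrix.smul_apply, smul_eq_mul]

theorem trace_op_mul (p q : PauliString n) :
    (p.op * q.op).trace = if p = q then (2 : ℂ) ^ n else 0 := by
  have key : (p.op * q.op).trace = ∏ k, ((p k).toMatrix * (q k).toMatrix).trace := by
    simp only [Matrix.trace, Matrix.diag_apply, op_mul_apply]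
    rw [Finset.prod_univ_sum, Fintype.piFinset_univ]
  rw [key]
  simp only [Pauli.trace_mul]
  split_ifs with h
  · simp [h]
  · obtain ⟨k, hk⟩ := Function.ne_iff.mp h
    exact Finset.prod_eq_zero (Finset.mem_univ k) (if_neg hk)

theorem conjTranspose_op (p : PauliString n) : p.op.conjTranspose = p.op := by
  ext i j
  simp only [Matrix.conjTranspose_apply, op, star_prod]
  refine Finset.prod_congr rfl fun k _ => ?_
  rw [← Matrix.conjTranspose_apply, Pauli.conjTranspose_toMatrix]

/-- The commutator either vanishes or is twice a product, hence a nonzero multiple of a string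
adjacent to `T`. -/
theorem lie_mem_span_component {𝒢 : Set (PauliString n)} {V X T : PauliString n} (hX : X ∈ 𝒢)
    (hT : T ∈ component 𝒢 V) :
    ⁅X.op, T.op⁆ ∈ Submodule.span ℂ (op '' component 𝒢 V) := by
  rcases T.commute_or_anticommute X with h | h
  · rw [Ring.lie_def, h, sub_self]
    exact Submodule.zero_mem _
  · obtain ⟨c, r, hc, hr⟩ := T.exists_mul X
    have hrel : CommutatorRel T X r := by
      refine ⟨2 * c, mul_ne_zero two_ne_zero hc, ?_⟩
      rw [Ring.lie_def, ← neg_eq_iff_eq_neg.mpr h, sub_neg_eq_add, hr, ← two_smul ℂ, smul_smul]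
    have hrC : r ∈ component 𝒢 V := by
      have hadj : (commutatorGraph 𝒢).Adj T r := ⟨X, hX, hrel⟩
      rw [component, SimpleGraph.ConnectedComponent.mem_supp_iff] at hT ⊢
      rw [← hT]
      exact (SimpleGraph.ConnectedComponent.sound hadj.reachable).symm
    obtain ⟨d, -, hd⟩ := hrel
    rw [← lie_skew, hd]
    exact Submodule.neg_mem _ (Submodule.smul_mem _ _
      (Submodule.subset_span (Set.mem_image_of_mem _ hrC)))

end PauliString

/-! ### The span of a component is invariant under the group -/

section

variable {n : ℕ}

/-- By the Jacobi identity, the operators whose `ad` preserves a subspace are closed under the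
bracket, so the generators suffice. -/
theorem lie_mem_span_component {𝒢 : Set (PauliString n)} {V : PauliString n} {A : Operator n}
    (hA : A ∈ dynamicalLieAlgebra 𝒢) :
    ∀ M ∈ Submodule.span ℂ (PauliString.op '' component 𝒢 V),
      ⁅A, M⁆ ∈ Submodule.span ℂ (PauliString.op '' component 𝒢 V) := by
  induction hA using LieSubalgebra.lieSpan_induction with
  | mem A h =>
    obtain ⟨X, hX, rfl⟩ := h
    intro M hM
    induction hM using Submodule.span_induction with
    | mem M h =>
      obtain ⟨T, hT, rfl⟩ := h
      rw [Ring.lie_def, smul_mul_assoc, mul_smul_comm, ← smul_sub, ← Ring.lie_def]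
      exact Submodule.smul_mem _ _ (PauliString.lie_mem_span_component hX hT)
    | zero => rw [lie_zero]; exact Submodule.zero_mem _
    | add M N _ _ hM hN => rw [lie_add]; exact Submodule.add_mem _ hM hN
    | smul c M _ hM => rw [lie_smul]; exact Submodule.smul_mem _ _ hM
  | zero => intro M _; rw [zero_lie]; exact Submodule.zero_mem _
  | add A B _ _ hA hB =>
    intro M hM; rw [add_lie]; exact Submodule.add_mem _ (hA M hM) (hB M hM)
  | smul a A _ hA =>
    intro M hM
    have : ⁅a • A, M⁆ = (a : ℂ) • ⁅A, M⁆ := by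
      rw [Complex.coe_smul, smul_lie]
    rw [this]
    exact Submodule.smul_mem _ _ (hA M hM)
  | lie A B _ _ hA hB =>
    intro M hM
    rw [lie_lie]
    exact Submodule.sub_mem _ (hA _ (hB M hM)) (hB _ (hA M hM))

open scoped Matrix.Norms.Operator in
theorem exp_conj_mem_span_component {𝒢 : Set (PauliString n)} {V : PauliString n}
    {A M : Operator n} (hA : A ∈ dynamicalLieAlgebra 𝒢)
    (hM : M ∈ Submodule.span ℂ (PauliString.op '' component 𝒢 V)) :
    NormedSpace.exp A * M * NormedSpace.exp (-A) ∈
      Submodule.span ℂ (PauliString.op '' component 𝒢 V) := by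
  refine exp_mul_mul_exp_neg_mem _ (Submodule.closed_of_finiteDimensional _) (fun B hB => ?_) hM
  rw [← Ring.lie_def]
  exact lie_mem_span_component hA B hB

/-- The unitaries whose conjugation action preserves a given subspace of operators. -/
def unitaryStabilizer (S : Submodule ℂ (Operator n)) : Subgroup (UGroup n) where
  -- Imposing the condition on `U⁻¹` as well makes closure under inverses immediate.
  carrier := {U | ∀ M ∈ S, heisenberg U M ∈ S ∧ heisenberg U⁻¹ M ∈ S}
  one_mem' M hM := by simpa [heisenberg] using hM
  mul_mem' {U U'} h h' M hM := by
    constructor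
    · have := (h' _ (h M hM).1).1
      simpa [heisenberg, mul_assoc] using this
    · have := (h _ (h' M hM).2).2
      simpa [heisenberg, mul_assoc] using this
  inv_mem' {U} h M hM := by
    rw [inv_inv]
    exact (h M hM).symm

theorem continuous_heisenberg (M : Operator n) : Continuous fun U : UGroup n => heisenberg U M := by
  unfold heisenberg
  exact ((continuous_subtype_val.matrix_conjTranspose).mul continuous_const).mul
    continuous_subtype_val

theorem isClosed_unitaryStabilizer (S : Submodule ℂ (Operator n)) :
    IsClosed (unitaryStabilizer S : Set (UGroup n)) := by
  have hS : IsClosed (S : Set (Operator n)) := Submodule.closed_of_finiteDimensional S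
  have : (unitaryStabilizer S : Set (UGroup n)) = ⋂ M ∈ S,
      (fun U : UGroup n => heisenberg U M) ⁻¹' S ∩ (fun U : UGroup n => heisenberg U⁻¹ M) ⁻¹' S := by
    ext U
    simp only [Set.mem_iInter]
    exact Iff.rfl
  rw [this]
  exact isClosed_biInter fun M _ => (hS.preimage (continuous_heisenberg M)).inter
    (hS.preimage ((continuous_heisenberg M).comp continuous_inv))

theorem dynamicalGroup_le_unitaryStabilizer (𝒢 : Set (PauliString n)) (V : PauliString n) :
    dynamicalGroup 𝒢 ≤
      unitaryStabilizer (Submodule.span ℂ (PauliString.op '' component 𝒢 V)) := by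
  refine Subgroup.topologicalClosure_minimal _ ((Subgroup.closure_le _).mpr ?_)
    (isClosed_unitaryStabilizer _)
  rintro U ⟨A, hA, hU⟩ M hM
  -- Both sides are inverse to the unitary `U`, so `A` need not be shown skew-Hermitian.
  have h1 : NormedSpace.exp (-A) = (U : Operator n).conjTranspose := by
    have e : NormedSpace.exp (-A) * NormedSpace.exp A = 1 := by
      rw [← Matrix.exp_add_of_commute _ _ (Commute.refl A).neg_left, neg_add_cancel,
        NormedSpace.exp_zero]
    rw [← hU] at e
    exact left_inv_eq_right_inv e (mul_eq_one_comm.mp (Matrix.UnitaryGroup.star_mul_self U))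
  constructor
  · have := exp_conj_mem_span_component (neg_mem hA) hM
    rw [neg_neg, h1, ← hU] at this
    exact this
  · have := exp_conj_mem_span_component hA hM
    rw [h1, ← hU] at this
    simpa [heisenberg, Matrix.star_eq_conjTranspose] using this

/-! ### Pauli coefficients and the correlator -/

/-- The coefficient of the Pauli string `T` in the Pauli expansion of `M`. -/
noncomputable def pauliCoeff (T : PauliString n) (M : Operator n) : ℂ :=
  (1 / (2 : ℂ) ^ n) * (T.op * M).trace

theorem pauliCoeff_op (S T : PauliString n) : pauliCoeff T S.op = if T = S then 1 else 0 := by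
  rw [pauliCoeff, PauliString.trace_op_mul]
  split_ifs <;> simp

theorem pauliCoeff_smul (T : PauliString n) (c : ℂ) (M : Operator n) :
    pauliCoeff T (c • M) = c * pauliCoeff T M := by
  simp only [pauliCoeff, Matrix.mul_smul, Matrix.trace_smul, smul_eq_mul]
  ring

theorem pauliCoeff_add (T : PauliString n) (M N : Operator n) :
    pauliCoeff T (M + N) = pauliCoeff T M + pauliCoeff T N := by
  simp only [pauliCoeff, Matrix.mul_add, Matrix.trace_add]
  ring

theorem sum_pauliCoeff_smul {C : Finset (PauliString n)} {M : Operator n}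
    (hM : M ∈ Submodule.span ℂ (PauliString.op '' (C : Set (PauliString n)))) :
    ∑ T ∈ C, pauliCoeff T M • T.op = M := by
  induction hM using Submodule.span_induction with
  | mem M h =>
    obtain ⟨S, hS, rfl⟩ := h
    simp_rw [pauliCoeff_op, ite_smul, one_smul, zero_smul]
    rw [Finset.sum_ite_eq' C S, if_pos (Finset.mem_coe.mp hS)]
  | zero => simp [pauliCoeff]
  | add M N _ _ hM hN =>
    simp_rw [pauliCoeff_add, add_smul, Finset.sum_add_distrib, hM, hN]
  | smul c M _ hM => simp_rw [pauliCoeff_smul, mul_smul, ← Finset.smul_sum, hM]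

/-- The sign picked up when the Pauli string `T` is conjugated by `W`. -/
noncomputable def commSign (W T : PauliString n) : ℂ :=
  open Classical in if W.op * T.op + T.op * W.op = 0 then -1 else 1

theorem op_mul_op_mul_op (W T : PauliString n) : W.op * T.op * W.op = commSign W T • T.op := by
  have hW := W.op_mul_self
  unfold commSign
  split_ifs with h
  · rw [eq_neg_of_add_eq_zero_left h, neg_mul, mul_assoc, hW, mul_one, neg_one_smul]
  · rcases W.commute_or_anticommute T with h' | h'
    · rw [h', mul_assoc, hW, mul_one, one_smul]
    · exact absurd (by rw [h', neg_add_cancel]) h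

theorem otoc_eq_sum {C : Finset (PauliString n)} {W : PauliString n} {M : Operator n}
    (hH : M.conjTranspose = M)
    (hM : M ∈ Submodule.span ℂ (PauliString.op '' (C : Set (PauliString n)))) :
    otoc W.op M = ∑ T ∈ C, commSign W T * pauliCoeff T M ^ 2 := by
  have h : W.op * M * W.op = ∑ T ∈ C, (commSign W T * pauliCoeff T M) • T.op := by
    conv_lhs => rw [← sum_pauliCoeff_smul hM]
    rw [Finset.mul_sum, Finset.sum_mul]
    refine Finset.sum_congr rfl fun T _ => ?_
    rw [mul_smul_comm, smul_mul_assoc, op_mul_op_mul_op, smul_smul, mul_comm]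
  rw [otoc, W.conjTranspose_op, hH, h, Finset.sum_mul, Matrix.trace_sum, Finset.mul_sum]
  refine Finset.sum_congr rfl fun T _ => ?_
  rw [smul_mul_assoc, Matrix.trace_smul, smul_eq_mul, sq, pauliCoeff]
  ring

/-- Parseval's identity for the bilinear form `tr (M N) / 2 ^ n`; this is why squares appear in
place of squared moduli. -/
theorem sum_pauliCoeff_sq {C : Finset (PauliString n)} {M : Operator n} (h1 : M * M = 1)
    (hM : M ∈ Submodule.span ℂ (PauliString.op '' (C : Set (PauliString n)))) :
    ∑ T ∈ C, pauliCoeff T M ^ 2 = 1 := by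
  have h : ∑ T ∈ C, pauliCoeff T M ^ 2 = (1 / (2 : ℂ) ^ n) * (M * M).trace := by
    conv_rhs => enter [2, 1, 1]; rw [← sum_pauliCoeff_smul hM]
    rw [Finset.sum_mul, Matrix.trace_sum, Finset.mul_sum]
    refine Finset.sum_congr rfl fun T _ => ?_
    rw [smul_mul_assoc, Matrix.trace_smul, smul_eq_mul, sq, pauliCoeff]
    ring
  rw [h, h1, Matrix.trace_one]
  simp

theorem heisenberg_conjTranspose (U : UGroup n) (V : PauliString n) :
    (heisenberg U V.op).conjTranspose = heisenberg U V.op := by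
  simp [heisenberg, Matrix.conjTranspose_mul, V.conjTranspose_op, mul_assoc]

theorem heisenberg_mul_self (U : UGroup n) (V : PauliString n) :
    heisenberg U V.op * heisenberg U V.op = 1 := by
  have h1 : (U : Operator n) * (U : Operator n).conjTranspose = 1 :=
    mul_eq_one_comm.mp (Matrix.UnitaryGroup.star_mul_self U)
  have h2 : (U : Operator n).conjTranspose * (U : Operator n) = 1 :=
    Matrix.UnitaryGroup.star_mul_self U
  calc heisenberg U V.op * heisenberg U V.op
      = (U : Operator n).conjTranspose *
        (V.op * ((U : Operator n) * (U : Operator n).conjTranspose) * V.op) * U := by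
        simp only [heisenberg, mul_assoc]
    _ = 1 := by rw [h1, mul_one, V.op_mul_self, mul_one, h2]

/-! ### Rotations along edges of the commutator graph -/

open scoped Matrix.Norms.Operator in
/-- The Clifford rotation `exp (i π X / 4) = (1 + i X) / √2` belongs to `exp 𝔤`. -/
theorem exists_mem_dynamicalGroup_eq {𝒢 : Set (PauliString n)} {X : PauliString n} (hX : X ∈ 𝒢) :
    ∃ g ∈ dynamicalGroup 𝒢, ∃ s : ℂ, star s = s ∧ s * s = 1 / 2 ∧
      (g : Operator n) = s • (1 + Complex.I • X.op) := by
  set s : ℂ := ((√2 / 2 : ℝ) : ℂ) with hs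
  have hstar : star s = s := Complex.conj_ofReal _
  have hss : s * s = 1 / 2 := by
    rw [hs, ← Complex.ofReal_mul, div_mul_div_comm, Real.mul_self_sqrt (by norm_num)]
    norm_num
  have hconj : (s • (1 + Complex.I • X.op) : Operator n).conjTranspose
      = s • (1 - Complex.I • X.op) := by
    rw [Matrix.conjTranspose_smul, hstar, Matrix.conjTranspose_add, Matrix.conjTranspose_smul,
      X.conjTranspose_op, Matrix.conjTranspose_one, Complex.star_def, Complex.conj_I, neg_smul,
      sub_eq_add_neg]
  have hu : s • (1 + Complex.I • X.op) ∈ Matrix.unitaryGroup (Qubits n) ℂ := by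
    rw [Matrix.mem_unitaryGroup_iff, Matrix.star_eq_conjTranspose, hconj, smul_mul_smul_comm, hss,
      add_mul, one_mul, mul_sub, mul_one, smul_mul_smul_comm, X.op_mul_self, Complex.I_mul_I]
    module
  refine ⟨⟨_, hu⟩, Subgroup.le_topologicalClosure _ (Subgroup.subset_closure ?_), s, hstar, hss, rfl⟩
  refine ⟨(Real.pi / 4 : ℝ) • (Complex.I • X.op),
    (dynamicalLieAlgebra 𝒢).smul_mem _ (LieSubalgebra.subset_lieSpan ⟨X, hX, rfl⟩), ?_⟩
  rw [← Complex.coe_smul, smul_smul]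
  refine Eq.trans ?_ (exp_involution X.op_mul_self _).symm
  rw [← Complex.ofReal_cos, ← Complex.ofReal_sin, Real.cos_pi_div_four, Real.sin_pi_div_four, ← hs]
  module

/-- Some group element moves each Pauli string to a given neighbour in the commutator graph, up to
sign. -/
theorem exists_pauliCoeff_sq_mul_eq {𝒢 : Set (PauliString n)} {S T : PauliString n}
    (h : (commutatorGraph 𝒢).Adj S T) :
    ∃ g : dynamicalGroup 𝒢, ∀ (U : dynamicalGroup 𝒢) (M : Operator n),
      pauliCoeff S (heisenberg ((U * g : dynamicalGroup 𝒢) : UGroup n) M) ^ 2 =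
        pauliCoeff T (heisenberg (U : UGroup n) M) ^ 2 := by
  obtain ⟨X, hX, hrel⟩ := h
  obtain ⟨g, hg, s, hstar, hss, hgX⟩ := exists_mem_dynamicalGroup_eq hX
  have ha := hrel.anticommute
  obtain ⟨c, hc, hrel⟩ := hrel
  have hXX := X.op_mul_self
  have hXS : X.op * S.op = (-(c / 2)) • T.op := by
    have : (2 : ℂ) • (X.op * S.op) = (-c) • T.op := by
      rw [neg_smul, ← hrel, Ring.lie_def, ha, two_smul]
      abel
    rw [← inv_smul_smul₀ (two_ne_zero' ℂ) (X.op * S.op), this, smul_smul]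
    congr 1
    ring
  have hconj : (g : Operator n).conjTranspose = s • (1 - Complex.I • X.op) := by
    rw [hgX, Matrix.conjTranspose_smul, hstar, Matrix.conjTranspose_add, Matrix.conjTranspose_smul,
      X.conjTranspose_op, Matrix.conjTranspose_one, Complex.star_def, Complex.conj_I, neg_smul,
      sub_eq_add_neg]
  -- As `X` and `S` anticommute, `g S g† = i X S`, which is `d T`.
  set d : ℂ := Complex.I * -(c / 2) with hd
  have hgS : (g : Operator n) * S.op * (g : Operator n).conjTranspose = d • T.op := by
    have e1 : X.op * S.op * X.op = - S.op := by
      rw [mul_assoc, ha, mul_neg, ← mul_assoc, hXX, one_mul]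
    rw [hconj, hgX, hd, mul_smul, ← hXS, smul_mul_assoc, smul_mul_smul_comm, hss, add_mul, one_mul,
      smul_mul_assoc, mul_sub, mul_one, mul_smul_comm, add_mul, ha, smul_mul_assoc, e1]
    simp only [smul_add, smul_sub, smul_neg, smul_smul, Complex.I_mul_I]
    module
  -- A conjugate of the involution `S` is an involution, and so is `T`; which sign `d` has is
  -- irrelevant.
  have hd2 : d ^ 2 = 1 := by
    have e1 : (g : Operator n).conjTranspose * (g : Operator n) = 1 :=
      Matrix.UnitaryGroup.star_mul_self g
    have e2 : (d • T.op) * (d • T.op) = (1 : Operator n) := by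
      rw [← hgS]
      calc _ = (g : Operator n) * (S.op * ((g : Operator n).conjTranspose * (g : Operator n))
            * S.op) * (g : Operator n).conjTranspose := by simp only [mul_assoc]
        _ = 1 := by rw [e1, mul_one, S.op_mul_self, mul_one, mul_eq_one_comm.mp e1]
    rw [smul_mul_smul_comm, T.op_mul_self] at e2
    have := congrArg (fun M : Operator n => M 0 0) e2
    simpa [sq] using this
  refine ⟨⟨g, hg⟩, fun U M => ?_⟩
  have : pauliCoeff S (heisenberg ((U : UGroup n) * g) M) =
      d * pauliCoeff T (heisenberg (U : UGroup n) M) := by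
    -- Cyclicity of the trace moves the conjugation by `g` from the evolved operator onto `S`.
    have e : (S.op * heisenberg ((U : UGroup n) * g) M).trace =
        ((g : Operator n) * S.op * (g : Operator n).conjTranspose
          * heisenberg (U : UGroup n) M).trace := by
      have e0 : heisenberg ((U : UGroup n) * g) M =
          (g : Operator n).conjTranspose * heisenberg (U : UGroup n) M * g := by
        simp only [heisenberg, Submonoid.coe_mul, Matrix.conjTranspose_mul, mul_assoc]
      rw [e0, ← mul_assoc, Matrix.trace_mul_comm]
      simp only [mul_assoc]
    rw [pauliCoeff, e, hgS, smul_mul_assoc, Matrix.trace_smul, smul_eq_mul, pauliCoeff]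
    ring
  change pauliCoeff S (heisenberg ((U : UGroup n) * g) M) ^ 2 = _
  rw [this, mul_pow, hd2, one_mul]

/-! ### Haar averages of squared coefficients and of the correlator -/

instance instIsHaarMeasureHaarMeasureG (𝒢 : Set (PauliString n)) :
    (haarMeasureG 𝒢).IsHaarMeasure :=
  Measure.isHaarMeasure_haarMeasure _

instance instIsProbabilityMeasureHaarMeasureG (𝒢 : Set (PauliString n)) :
    IsProbabilityMeasure (haarMeasureG 𝒢) :=
  ⟨Measure.haarMeasure_self⟩

instance instIsMulRightInvariantHaarMeasureG (𝒢 : Set (PauliString n)) :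
    (haarMeasureG 𝒢).IsMulRightInvariant :=
  isMulRightInvariant_of_isProbabilityMeasure _

instance instIsInvInvariantHaarMeasureG (𝒢 : Set (PauliString n)) :
    (haarMeasureG 𝒢).IsInvInvariant :=
  isInvInvariant_of_isProbabilityMeasure _

theorem integrable_haarMeasureG {𝒢 : Set (PauliString n)} {f : dynamicalGroup 𝒢 → ℂ}
    (hf : Continuous f) : Integrable f (haarMeasureG 𝒢) :=
  hf.integrable_of_hasCompactSupport (HasCompactSupport.of_compactSpace f)

theorem integrable_pauliCoeff_sq (𝒢 : Set (PauliString n)) (T : PauliString n) (M : Operator n) :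
    Integrable (fun U : dynamicalGroup 𝒢 => pauliCoeff T (heisenberg (U : UGroup n) M) ^ 2)
      (haarMeasureG 𝒢) := by
  refine integrable_haarMeasureG ?_
  have h := (continuous_heisenberg M).comp (continuous_subtype_val (p := (· ∈ dynamicalGroup 𝒢)))
  exact (continuous_const.mul (continuous_const.mul h).matrix_trace).pow 2

theorem integral_pauliCoeff_sq_eq_of_adj {𝒢 : Set (PauliString n)} {S T : PauliString n}
    (h : (commutatorGraph 𝒢).Adj S T) (M : Operator n) :
    ∫ U : dynamicalGroup 𝒢, pauliCoeff S (heisenberg (U : UGroup n) M) ^ 2 ∂(haarMeasureG 𝒢) =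
      ∫ U : dynamicalGroup 𝒢, pauliCoeff T (heisenberg (U : UGroup n) M) ^ 2 ∂(haarMeasureG 𝒢) := by
  obtain ⟨g, hg⟩ := exists_pauliCoeff_sq_mul_eq h
  rw [← integral_mul_right_eq_self
    (fun U : dynamicalGroup 𝒢 => pauliCoeff S (heisenberg (U : UGroup n) M) ^ 2) g]
  exact integral_congr_ae (Filter.Eventually.of_forall fun U => hg U M)

theorem integral_pauliCoeff_sq_eq_of_reachable {𝒢 : Set (PauliString n)} {S T : PauliString n}
    (h : (commutatorGraph 𝒢).Reachable S T) (M : Operator n) :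
    ∫ U : dynamicalGroup 𝒢, pauliCoeff S (heisenberg (U : UGroup n) M) ^ 2 ∂(haarMeasureG 𝒢) =
      ∫ U : dynamicalGroup 𝒢, pauliCoeff T (heisenberg (U : UGroup n) M) ^ 2 ∂(haarMeasureG 𝒢) := by
  obtain ⟨p⟩ := h
  induction p with
  | nil => rfl
  | cons h _ ih => exact (integral_pauliCoeff_sq_eq_of_adj h M).trans ih

theorem mem_component_self (𝒢 : Set (PauliString n)) (V : PauliString n) : V ∈ component 𝒢 V :=
  rfl

theorem heisenberg_mem_span_component {𝒢 : Set (PauliString n)} (U : dynamicalGroup 𝒢)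
    (V : PauliString n) :
    heisenberg (U : UGroup n) V.op ∈ Submodule.span ℂ (PauliString.op '' component 𝒢 V) :=
  (dynamicalGroup_le_unitaryStabilizer 𝒢 V U.2 _
    (Submodule.subset_span (Set.mem_image_of_mem _ (mem_component_self 𝒢 V)))).1

/-- The weight of the evolved operator is uniformly distributed over the component. -/
theorem integral_pauliCoeff_sq {𝒢 : Set (PauliString n)} {V T : PauliString n}
    (hT : T ∈ component 𝒢 V) :
    ∫ U : dynamicalGroup 𝒢, pauliCoeff T (heisenberg (U : UGroup n) V.op) ^ 2 ∂(haarMeasureG 𝒢) =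
      1 / ((component 𝒢 V).ncard : ℂ) := by
  classical
  set C : Finset (PauliString n) := (component 𝒢 V).toFinset with hC
  have hCc : (C : Set (PauliString n)) = component 𝒢 V := Set.coe_toFinset _
  -- The averages add up to `1` and are all equal, which determines them.
  have hsum : ∑ S ∈ C, ∫ U : dynamicalGroup 𝒢,
      pauliCoeff S (heisenberg (U : UGroup n) V.op) ^ 2 ∂(haarMeasureG 𝒢) = 1 := by
    rw [← integral_finsetSum _ fun S _ => integrable_pauliCoeff_sq 𝒢 S V.op]
    have : ∀ U : dynamicalGroup 𝒢,
        ∑ S ∈ C, pauliCoeff S (heisenberg (U : UGroup n) V.op) ^ 2 = 1 := fun U =>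
      sum_pauliCoeff_sq (heisenberg_mul_self _ V) (hCc ▸ heisenberg_mem_span_component U V)
    simp [this]
  have hconst : ∀ S ∈ C, ∫ U : dynamicalGroup 𝒢,
      pauliCoeff S (heisenberg (U : UGroup n) V.op) ^ 2 ∂(haarMeasureG 𝒢) =
      ∫ U : dynamicalGroup 𝒢,
        pauliCoeff T (heisenberg (U : UGroup n) V.op) ^ 2 ∂(haarMeasureG 𝒢) := fun S hS =>
    integral_pauliCoeff_sq_eq_of_reachable (SimpleGraph.ConnectedComponent.exact
      ((Set.mem_toFinset.mp hS).trans hT.symm)) V.op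
  rw [Finset.sum_congr rfl hconst, Finset.sum_const, nsmul_eq_mul] at hsum
  rw [Set.ncard_eq_toFinset_card', ← hC]
  exact eq_one_div_of_mul_eq_one_right hsum

theorem continuous_otoc_heisenberg (𝒢 : Set (PauliString n)) (V W : Operator n) :
    Continuous fun U : dynamicalGroup 𝒢 => otoc W (heisenberg (U : UGroup n) V) := by
  have h := (continuous_heisenberg V).comp (continuous_subtype_val (p := (· ∈ dynamicalGroup 𝒢)))
  exact continuous_const.mul (((continuous_const.mul h.matrix_conjTranspose).mul
    continuous_const).mul h).matrix_trace

theorem integral_otoc (𝒢 : Set (PauliString n)) (V W : PauliString n) :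
    ∫ U : dynamicalGroup 𝒢, otoc W.op (heisenberg (U : UGroup n) V.op) ∂(haarMeasureG 𝒢) =
      1 - 2 * ((anticommutingIn 𝒢 V W).ncard : ℂ) / ((component 𝒢 V).ncard : ℂ) := by
  classical
  set C : Finset (PauliString n) := (component 𝒢 V).toFinset with hC
  have hCc : (C : Set (PauliString n)) = component 𝒢 V := Set.coe_toFinset _
  have hne : ((component 𝒢 V).ncard : ℂ) ≠ 0 :=
    Nat.cast_ne_zero.mpr (Set.ncard_ne_zero_of_mem (mem_component_self 𝒢 V))
  have hsum : ∀ U : dynamicalGroup 𝒢, otoc W.op (heisenberg (U : UGroup n) V.op) =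
      ∑ T ∈ C, commSign W T * pauliCoeff T (heisenberg (U : UGroup n) V.op) ^ 2 := fun U =>
    otoc_eq_sum (heisenberg_conjTranspose _ V) (hCc ▸ heisenberg_mem_span_component U V)
  -- Each anticommuting string contributes `-1` instead of `1`, lowering the sum from `|C(V)|` by
  -- `2`.
  have hsign : ∑ T ∈ C, commSign W T =
      (component 𝒢 V).ncard - 2 * ((anticommutingIn 𝒢 V W).ncard : ℂ) := by
    have h1 : ∀ T, commSign W T =
        1 - 2 * if W.op * T.op + T.op * W.op = 0 then (1 : ℂ) else 0 := fun T => by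
      unfold commSign
      split_ifs <;> norm_num
    have h2 : anticommutingIn 𝒢 V W = (C.filter fun T => W.op * T.op + T.op * W.op = 0 :) := by
      ext T
      simp [anticommutingIn, hC]
    rw [h2, Set.ncard_coe_finset, ← hCc, Set.ncard_coe_finset, Finset.sum_congr rfl fun T _ => h1 T,
      Finset.sum_sub_distrib, ← Finset.mul_sum, Finset.sum_boole]
    simp
  simp_rw [hsum]
  rw [integral_finsetSum _ fun T _ => (integrable_pauliCoeff_sq 𝒢 T V.op).const_mul _]
  simp_rw [integral_const_mul]
  rw [Finset.sum_congr rfl fun T hT => by rw [integral_pauliCoeff_sq (Set.mem_toFinset.mp hT)],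
    ← Finset.sum_mul, hsign]
  field_simp

/-! ### Symmetry between the two operators -/

/-- Time reversal exchanges the two operators of the correlator. -/
theorem otoc_heisenberg_inv (U : UGroup n) (V W : PauliString n) :
    otoc W.op (heisenberg U⁻¹ V.op) = otoc V.op (heisenberg U W.op) := by
  unfold otoc
  rw [heisenberg_conjTranspose, heisenberg_conjTranspose, W.conjTranspose_op, V.conjTranspose_op]
  have h : ((U⁻¹ : UGroup n) : Operator n) = (U : Operator n).conjTranspose := rfl
  refine congrArg ((1 / (2 : ℂ) ^ n) * ·) ?_
  simp only [heisenberg, h, Matrix.conjTranspose_conjTranspose]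
  generalize (U : Operator n) = u
  calc _ = ((W.op * u) * (V.op * u.conjTranspose * W.op * u * V.op * u.conjTranspose)).trace := by
        simp only [mul_assoc]
    _ = _ := by rw [Matrix.trace_mul_comm]; simp only [mul_assoc]

theorem integral_otoc_comm (𝒢 : Set (PauliString n)) (V W : PauliString n) :
    ∫ U : dynamicalGroup 𝒢, otoc W.op (heisenberg (U : UGroup n) V.op) ∂(haarMeasureG 𝒢) =
      ∫ U : dynamicalGroup 𝒢, otoc V.op (heisenberg (U : UGroup n) W.op) ∂(haarMeasureG 𝒢) := by
  have h := integral_inv_eq_self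
    (fun U : dynamicalGroup 𝒢 => otoc W.op (heisenberg (U : UGroup n) V.op)) (haarMeasureG 𝒢)
  have h' : ∀ U : dynamicalGroup 𝒢,
      otoc W.op (heisenberg ((U⁻¹ : dynamicalGroup 𝒢) : UGroup n) V.op) =
        otoc V.op (heisenberg (U : UGroup n) W.op) := fun U => by
    rw [InvMemClass.coe_inv, otoc_heisenberg_inv]
  simp only [h'] at h
  exact h.symm

end

theorem corollary1 (n : ℕ) (𝒢 : Set (PauliString n)) (V W : PauliString n) :
    Integrable (fun U : dynamicalGroup 𝒢 => otoc W.op (heisenberg (U : UGroup n) V.op))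
        (haarMeasureG 𝒢) ∧
      ∫ U : dynamicalGroup 𝒢, otoc W.op (heisenberg (U : UGroup n) V.op) ∂(haarMeasureG 𝒢) =
        1 - 2 * ((anticommutingIn 𝒢 V W).ncard : ℂ) / ((component 𝒢 V).ncard : ℂ) ∧
      ∫ U : dynamicalGroup 𝒢, otoc W.op (heisenberg (U : UGroup n) V.op) ∂(haarMeasureG 𝒢) =
        1 - 2 * ((anticommutingIn 𝒢 W V).ncard : ℂ) / ((component 𝒢 W).ncard : ℂ) := by
  refine ⟨integrable_haarMeasureG (continuous_otoc_heisenberg 𝒢 V.op W.op), integral_otoc 𝒢 V W,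
    ?_⟩
  rw [integral_otoc_comm, integral_otoc 𝒢 W V]
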